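/- A hypergraph $G=(V,E)$ has a finite vertex set $V$ and a finite family $E$ of hyperedges, each a nonempty subset of $V$ (parallel hyperedges are allowed); the rank of a hyperedge is its number of vertices, and $n=|V|$. $G$ is disconnected if $V$ can be partitioned into two nonempty sides such that every hyperedge lies entirely in one side. A cut is a set $C\subseteq E$ such that $G-C=(V,E\setminus C)$ is disconnected, and $\lambda$ is the minimum number of hyperedges in a cut of $G$. For $F\subseteq E$, the contracted hypergraph $G/F$ is obtained by merging, for each $e\in F$, all vertices of $e$ into one, and replacing every hyperedge by its image. For $q\in(0,1)$, $H\sim G(q)$ is the random hypergraph $G/F$, where $F$ contains each hyperedge of $G$ independently with probability $1-q$. (1) For every real $A>1$ there is a constant $n_0=n_0(A)$ such that the following holds for every real $B$ with $1<B<A$. Let $G$ be a hypergraph with $n\ge n_0$ vertices in which every hyperedge has rank at most $R=n/A$, let $q\in(0,1)$ and let $H\sim G(q)$. Then $$\Pr\bigl[\,|V(H)|\ge \lceil BR\rceil+1\,\bigr] < n^{A^2/B}\,q^{B\lambda}.$$ (2) There is a constant $n_0$ such that, for every hypergraph $G$ with $n\ge n_0$ vertices in which every hyperedge has rank at most $n/2$,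 every $q\in(0,1)$, and $H\sim G(q)$, $$\Pr\bigl[\,|V(H)|\ge 0.8\,n\,\bigr]\le n^{2.7}\,q^{1.5\lambda}.$$ -/

import Mathlib

/-- A hypergraph with vertex set `V` whose hyperedges are indexed by `E`: every hyperedge is a
nonempty set of vertices. Parallel hyperedges (distinct indices with the same vertex set) are
allowed; an injective `verts` is a hypergraph given by a set of hyperedges. -/
structure MultiHypergraph (V : Type*) (E : Type*) where
  /-- the set of vertices of a hyperedge -/
  verts : E → Finset V
  verts_nonempty : ∀ e, (verts e).Nonempty

namespace MultiHypergraph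

/-- The number of vertices. -/
noncomputable def numVertices {V E : Type*} (_G : MultiHypergraph V E) : ℕ := Nat.card V

/-- The rank of a hyperedge: its number of vertices. -/
def rank {V E : Type*} (G : MultiHypergraph V E) (e : E) : ℕ := (G.verts e).card

/-- `G - C`: delete the hyperedges in `C`, keep all vertices. -/
def deleteEdges {V E : Type*} (G : MultiHypergraph V E) (C : Finset E) :
    MultiHypergraph V {e : E // e ∉ C} where
  verts e := G.verts e
  verts_nonempty e := G.verts_nonempty e

/-- A hypergraph is disconnected if its vertices have a bipartition into two nonempty sides such
that every hyperedge is entirely contained in one of the sides. -/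
def IsDisconnected {V E : Type*} (G : MultiHypergraph V E) : Prop :=
  ∃ S : Set V, S.Nonempty ∧ Sᶜ.Nonempty ∧
    ∀ e, (G.verts e : Set V) ⊆ S ∨ (G.verts e : Set V) ⊆ Sᶜ

/-- A cut is a set `C` of hyperedges such that `G - C` is disconnected. -/
def IsCut {V E : Type*} (G : MultiHypergraph V E) (C : Finset E) : Prop :=
  (G.deleteEdges C).IsDisconnected

/-- The value `λ_G` of a minimum cut. (If there are finitely many hyperedges and at least two
vertices, then the set of all hyperedges is a cut, so the infimum is a minimum.) -/
noncomputable def minCut {V E : Type*} (G : MultiHypergraph V E) : ℕ :=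
  sInf {k : ℕ | ∃ C : Finset E, G.IsCut C ∧ C.card = k}

/-- The equivalence relation on vertices whose classes are the supervertices of `G / F`: the one
generated by identifying any two vertices that lie in a common hyperedge of `F`. -/
def contractSetoid {V E : Type*} (G : MultiHypergraph V E) (F : Finset E) : Setoid V :=
  Relation.EqvGen.setoid fun u v => ∃ e ∈ F, u ∈ G.verts e ∧ v ∈ G.verts e

open Classical in
/-- `G / F`: contract all hyperedges in `F`. The vertices are the supervertices, and every
hyperedge is replaced by its image under the natural map `V → V / F`. -/
noncomputable def contract {V E : Type*} (G : MultiHypergraph V E) (F : Finset E) :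
    MultiHypergraph (Quotient (G.contractSetoid F)) E where
  verts e := (G.verts e).image (Quotient.mk (G.contractSetoid F))
  verts_nonempty e := (G.verts_nonempty e).image _

open Classical in
/-- The probability, for `H ∼ G(q)`, that `H` has at least `x` vertices: `H = G / F`, where the
random set `F` contains each hyperedge independently with probability `1 - q`. -/
noncomputable def probNumVerticesGe {V E : Type*} [Fintype E] (G : MultiHypergraph V E)
    (q x : ℝ) : ℝ :=
  ∑ F : Finset E, if x ≤ ((G.contract F).numVertices : ℝ)
    then ∏ e : E, (if e ∈ F then 1 - q else q) else 0

end MultiHypergraph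

/-!
Let `H = G / F` have `k` vertices. Contracting one more hyperedge of rank `r ≥ 2` in `H` leaves at
most `k - (r - 1) ≤ k - r / 2` vertices. Give `H` the potential `k ^ α` with `α = 2 * B * (B + 1)`,
cut off to `0` below a threshold `c ≥ B * R + 1`. For this `α` the contraction multiplies the
potential by at most `1 - B * r / k`; the cut-off does no harm, because `B * r ≤ B * R ≤ k` makes
that factor nonnegative. The hyperedges of rank at least two at a vertex of `H` form a cut, so the
ranks `r ≥ 2` sum to at least `k * λ`, and the decrements of the potential over all hyperedges sum
to at least `B * λ` times the potential.

By Russo's formula the expected potential `Φ` satisfies `B * λ * Φ ≤ q * dΦ/dq`, so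
`Φ / q ^ (B * λ)` is monotone up to `q = 1`, where no hyperedge is contracted. Markov's inequality
at the threshold `c` gives the tail bound `(n / c) ^ α * q ^ (B * λ)`, and for `c ≥ B * n / A` the
first factor is bounded independently of `n`.
-/

open Finset Real

lemma monotoneOn_mul_rpow_neg_of_mul_le_mul_deriv {f f' : ℝ → ℝ} {c : ℝ} {s : Set ℝ}
    (hs : Convex ℝ s) (hs_pos : s ⊆ Set.Ioi 0) (hf : ∀ t ∈ s, HasDerivAt f (f' t) t)
    (hle : ∀ t ∈ s, c * f t ≤ t * f' t) :
    MonotoneOn (fun t => f t * t ^ (-c)) s := by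
  have hderiv : ∀ t ∈ s, HasDerivAt (fun t => f t * t ^ (-c))
      (f' t * t ^ (-c) + f t * (-c * t ^ (-c - 1))) t := fun t ht =>
    (hf t ht).mul (hasDerivAt_rpow_const (Or.inl (hs_pos ht).ne'))
  refine monotoneOn_of_hasDerivWithinAt_nonneg hs
    (fun t ht => (hderiv t ht).continuousAt.continuousWithinAt)
    (fun t ht => (hderiv t (interior_subset ht)).hasDerivWithinAt) fun t ht => ?_
  have hts := interior_subset ht
  have ht_pos : 0 < t := hs_pos hts
  calc 0 ≤ (t * f' t - c * f t) * t ^ (-c - 1) :=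
        mul_nonneg (sub_nonneg.mpr (hle t hts)) (by positivity)
    _ = f' t * t ^ (-c) + f t * (-c * t ^ (-c - 1)) := by
        rw [rpow_sub_one ht_pos.ne']
        field_simp
        ring

section RandomSubset

variable {E : Type*} [Fintype E] [DecidableEq E]

/-- The probability that a random subset of `E`, which contains each element independently with
probability `1 - q`, equals `F`. -/
def subsetWeight (q : ℝ) (F : Finset E) : ℝ := (1 - q) ^ #F * q ^ #Fᶜ

/-- The expectation of `g F` for a random subset `F` of `E` that contains each element
independently with probability `1 - q`. -/
def subsetExpectation (q : ℝ) (g : Finset E → ℝ) : ℝ := ∑ F, subsetWeight q F * g F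

lemma prod_ite_mem_eq_subsetWeight (q : ℝ) (F : Finset E) :
    ∏ e, (if e ∈ F then 1 - q else q) = subsetWeight q F := by
  simp [subsetWeight, prod_ite, filter_notMem_eq_sdiff, ← compl_eq_univ_sdiff]

lemma subsetWeight_nonneg {q : ℝ} (hq : 0 ≤ q) (hq1 : q ≤ 1) (F : Finset E) :
    0 ≤ subsetWeight q F :=
  mul_nonneg (pow_nonneg (sub_nonneg.mpr hq1) _) (pow_nonneg hq _)

lemma subsetExpectation_mono {q : ℝ} (hq : 0 ≤ q) (hq1 : q ≤ 1) :
    Monotone (subsetExpectation (E := E) q) := fun _ _ hgh =>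
  sum_le_sum fun F _ => mul_le_mul_of_nonneg_left (hgh F) (subsetWeight_nonneg hq hq1 F)

lemma subsetExpectation_const_mul (q c : ℝ) (g : Finset E → ℝ) :
    subsetExpectation q (fun F => c * g F) = c * subsetExpectation q g := by
  simp only [subsetExpectation, mul_sum, mul_left_comm]

lemma subsetExpectation_one (g : Finset E → ℝ) : subsetExpectation 1 g = g ∅ := by
  have hweight : ∀ F : Finset E, F ≠ ∅ → subsetWeight 1 F = 0 := fun F hF => by
    simp [subsetWeight, hF]
  rw [subsetExpectation, Fintype.sum_eq_single ∅ fun F hF => by rw [hweight F hF, zero_mul]]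
  simp [subsetWeight]

lemma hasDerivAt_subsetWeight {q : ℝ} (hq : q ≠ 0) (F : Finset E) :
    HasDerivAt (fun t => subsetWeight t F)
      (q⁻¹ * (∑ _e ∈ Fᶜ, subsetWeight q F - ∑ e ∈ F, subsetWeight q (F.erase e))) q := by
  have herase : ∀ e ∈ F, subsetWeight q (F.erase e) = (1 - q) ^ (#F - 1) * q ^ (#Fᶜ + 1) :=
    fun e he => by
      rw [subsetWeight, card_erase_of_mem he, compl_erase, card_insert_of_notMem (by simpa)]
  have hpow : (#Fᶜ : ℝ) * q ^ (#Fᶜ - 1) = q⁻¹ * (#Fᶜ * q ^ #Fᶜ) := by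
    rcases Nat.eq_zero_or_pos #Fᶜ with h | h
    · simp [h]
    · rw [← pow_sub_one_mul h.ne' q]
      field_simp
  rw [sum_const, sum_congr rfl herase, sum_const, nsmul_eq_mul, nsmul_eq_mul, subsetWeight]
  refine ((((hasDerivAt_id' q).const_sub 1).fun_pow #F).mul
    (hasDerivAt_pow #Fᶜ q)).congr_deriv ?_
  rw [hpow]
  field_simp
  ring

lemma sum_sum_erase_eq_sum_sum_compl_insert {M : Type*} [AddCommMonoid M]
    (h : Finset E → Finset E → M) :
    ∑ F, ∑ e ∈ F, h (F.erase e) F = ∑ F, ∑ e ∈ Fᶜ, h F (insert e F) := by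
  rw [sum_sigma', sum_sigma']
  refine sum_nbij' (fun p => ⟨p.1.erase p.2, p.2⟩) (fun p => ⟨insert p.2 p.1, p.2⟩) ?_ ?_ ?_ ?_ ?_
  all_goals
    rintro ⟨F, e⟩ he
    simp only [mem_sigma, mem_univ, true_and, mem_compl] at he
    simp [insert_erase, he]

lemma hasDerivAt_subsetExpectation {q : ℝ} (hq : q ≠ 0) (g : Finset E → ℝ) :
    HasDerivAt (fun t => subsetExpectation t g)
      (q⁻¹ * subsetExpectation q fun F => ∑ e, (g F - g (insert e F))) q := by
  have hsum : ∀ F, ∑ e, (g F - g (insert e F)) = ∑ e ∈ Fᶜ, (g F - g (insert e F)) := fun F =>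
    (sum_subset (subset_univ _) fun e _ he => by
      rw [insert_eq_of_mem (by simpa using he), sub_self]).symm
  refine (HasDerivAt.fun_sum fun F _ =>
    (hasDerivAt_subsetWeight hq F).mul_const (g F)).congr_deriv ?_
  calc ∑ F, q⁻¹ * (∑ _e ∈ Fᶜ, subsetWeight q F - ∑ e ∈ F, subsetWeight q (F.erase e)) * g F
      = q⁻¹ * (∑ F, ∑ _e ∈ Fᶜ, subsetWeight q F * g F -
          ∑ F, ∑ e ∈ F, subsetWeight q (F.erase e) * g F) := by
        simp only [← sum_sub_distrib, mul_sum, ← sum_mul, mul_assoc, ← sub_mul]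
    _ = q⁻¹ * (∑ F, ∑ _e ∈ Fᶜ, subsetWeight q F * g F -
          ∑ F, ∑ e ∈ Fᶜ, subsetWeight q F * g (insert e F)) := by
        rw [sum_sum_erase_eq_sum_sum_compl_insert fun F F' => subsetWeight q F * g F']
    _ = q⁻¹ * subsetExpectation q fun F => ∑ e, (g F - g (insert e F)) := by
        simp only [subsetExpectation, hsum, mul_sum, mul_sub, ← sum_sub_distrib]

lemma subsetExpectation_le_mul_rpow {g : Finset E → ℝ} {c : ℝ}
    (hg : ∀ F, c * g F ≤ ∑ e, (g F - g (insert e F))) {q : ℝ} (hq : 0 < q) (hq1 : q ≤ 1) :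
    subsetExpectation q g ≤ g ∅ * q ^ c := by
  have hmono : MonotoneOn (fun t => subsetExpectation t g * t ^ (-c)) (Set.Ioc 0 1) := by
    refine monotoneOn_mul_rpow_neg_of_mul_le_mul_deriv (convex_Ioc 0 1) Set.Ioc_subset_Ioi_self
      (fun t ht => hasDerivAt_subsetExpectation ht.1.ne' g) fun t ht => ?_
    rw [mul_inv_cancel_left₀ ht.1.ne', ← subsetExpectation_const_mul]
    exact subsetExpectation_mono ht.1.le ht.2 hg
  have hle : subsetExpectation q g * q ^ (-c) ≤ g ∅ := by
    simpa [subsetExpectation_one] using hmono ⟨hq, hq1⟩ ⟨one_pos, le_rfl⟩ hq1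
  rwa [rpow_neg hq.le, ← div_eq_mul_inv, div_le_iff₀ (rpow_pos_of_pos hq c)] at hle

end RandomSubset

lemma natCard_add_card_le_of_surjective {α β : Type*} [Finite α] {f : α → β}
    (hf : f.Surjective) {I : Finset α} {b : β} (hI : ∀ x ∈ I, f x = b) :
    Nat.card β + #I ≤ Nat.card α + 1 := by
  classical
  have := Fintype.ofFinite α
  have := Finite.of_surjective f hf
  have := Fintype.ofFinite β
  have hcover : univ ⊆ insert b (Iᶜ.image f) := fun y _ => by
    obtain ⟨x, rfl⟩ := hf y
    by_cases hx : x ∈ I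
    · exact hI x hx ▸ mem_insert_self _ _
    · exact mem_insert_of_mem (mem_image_of_mem f (mem_compl.mpr hx))
  have hβ : Fintype.card β ≤ #Iᶜ + 1 :=
    (card_le_card hcover).trans <|
      (card_insert_le _ _).trans (Nat.add_le_add_right card_image_le 1)
  rw [Nat.card_eq_fintype_card, Nat.card_eq_fintype_card, ← card_add_card_compl I]
  lia

lemma one_sub_half_rpow_le {B x : ℝ} (hB : 0 < B) (hx : 0 ≤ x) (hBx : (B + 1) * x ≤ 1) :
    (1 - x / 2) ^ (2 * B * (B + 1)) ≤ 1 - B * x := by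
  have hx1 : x ≤ 1 := by nlinarith
  set y := B * (B + 1) * x with hy
  have : 0 ≤ y := by positivity
  calc (1 - x / 2) ^ (2 * B * (B + 1)) ≤ exp (-(x / 2)) ^ (2 * B * (B + 1)) :=
        rpow_le_rpow (by linarith) (one_sub_le_exp_neg _) (by positivity)
    _ = (exp y)⁻¹ := by rw [← exp_mul, ← exp_neg, hy]; ring_nf
    _ ≤ (y + 1)⁻¹ := inv_anti₀ (by positivity) (add_one_le_exp y)
    _ ≤ 1 - B * x := by
        have hslack : 0 ≤ B ^ 2 * x * (1 - (B + 1) * x) :=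
          mul_nonneg (by positivity) (sub_nonneg.mpr hBx)
        rw [inv_le_iff_one_le_mul₀ (by positivity), hy]
        linarith

lemma log_lt_pow_self {t : ℝ} (ht : 0 < t) {k : ℕ} (hk : k ≠ 0) : log t < t ^ k := by
  rcases lt_or_ge t 1 with h | h
  · exact (log_neg ht h).trans (by positivity)
  · calc log t ≤ t - 1 := log_le_sub_one_of_pos ht
      _ < t := sub_one_lt t
      _ ≤ t ^ k := le_self_pow₀ h hk

lemma div_rpow_lt_rpow_sq_div {A B n : ℝ} (hA : 0 < A) (hB : 0 < B)
    (hn : exp (2 * (A + 1)) ≤ n) :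
    (A / B) ^ (2 * B * (B + 1)) < n ^ (A ^ 2 / B) := by
  set t := A / B with ht
  have ht0 : 0 < t := by positivity
  have hAt : A = t * B := by rw [ht]; field_simp
  have hlog : log t * (B + 1) < B * t ^ 3 + t ^ 2 := by
    nlinarith [log_lt_pow_self ht0 two_ne_zero, log_lt_pow_self ht0 three_ne_zero]
  calc t ^ (2 * B * (B + 1)) = exp (log t * (2 * B * (B + 1))) := rpow_def_of_pos ht0 _
    _ < exp (2 * (A + 1) * (A ^ 2 / B)) := by
        rw [exp_lt_exp]
        have hexponent : 2 * (A + 1) * (A ^ 2 / B) = 2 * B * (B * t ^ 3 + t ^ 2) := by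
          rw [hAt]; field_simp
        nlinarith
    _ = exp (2 * (A + 1)) ^ (A ^ 2 / B) := exp_mul _ _
    _ ≤ n ^ (A ^ 2 / B) := rpow_le_rpow (exp_pos _).le hn (by positivity)

namespace MultiHypergraph

section Potential

/-- The potential of a hypergraph with `x` vertices: the power `x ^ α`, cut off to `0` once fewer
than `c` vertices are left. -/
noncomputable def potential (c α : ℝ) : ℝ → ℝ := (Set.Ici c).indicator (· ^ α)

variable {c α x : ℝ}

lemma potential_of_le (h : c ≤ x) : potential c α x = x ^ α := Set.indicator_of_mem h _

lemma potential_of_lt (h : x < c) : potential c α x = 0 := Set.indicator_of_notMem h.not_ge _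

lemma potential_nonneg (hc : 0 ≤ c) (x : ℝ) : 0 ≤ potential c α x :=
  Set.indicator_nonneg (fun _ hy => rpow_nonneg (hc.trans hy) _) x

lemma potential_le_rpow (hx : 0 ≤ x) : potential c α x ≤ x ^ α :=
  Set.indicator_apply_le' (fun _ => le_rfl) fun _ => rpow_nonneg hx α

lemma monotone_potential (hc : 0 ≤ c) (hα : 0 ≤ α) : Monotone (potential c α) := by
  intro x y hxy
  rcases lt_or_ge x c with hx | hx
  · exact potential_of_lt hx ▸ potential_nonneg hc y
  · rw [potential_of_le hx, potential_of_le (hx.trans hxy)]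
    exact rpow_le_rpow (hc.trans hx) hxy hα

lemma potential_le_one_sub_mul_potential {B R k k' r : ℝ} (hB : 0 < B) (hc : B * R + 1 ≤ c)
    (hr : 2 ≤ r) (hrR : r ≤ R) (hk : c ≤ k) (hk' : k' ≤ k - r + 1) :
    potential c (2 * B * (B + 1)) k' ≤ (1 - B * (r / k)) * potential c (2 * B * (B + 1)) k := by
  have hBr : B * r ≤ B * R := by gcongr
  have hk0 : 0 < k := by nlinarith
  rcases lt_or_ge k' c with hk'c | hk'c
  · have hBrk : B * (r / k) ≤ 1 := by
      rw [← mul_div_assoc, div_le_one hk0]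
      linarith
    rw [potential_of_lt hk'c]
    exact mul_nonneg (sub_nonneg.mpr hBrk) (potential_nonneg (by nlinarith) k)
  · have hk'0 : 0 < k' := by nlinarith
    have hsmall : (B + 1) * (r / k) ≤ 1 := by
      rw [← mul_div_assoc, div_le_one hk0]
      linarith
    have hshrink : k' ≤ (1 - r / k / 2) * k := by
      field_simp
      linarith
    rw [potential_of_le hk'c, potential_of_le hk]
    calc k' ^ (2 * B * (B + 1)) ≤ ((1 - r / k / 2) * k) ^ (2 * B * (B + 1)) :=
          rpow_le_rpow hk'0.le hshrink (by positivity)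
      _ = (1 - r / k / 2) ^ (2 * B * (B + 1)) * k ^ (2 * B * (B + 1)) :=
          mul_rpow (by nlinarith) hk0.le
      _ ≤ (1 - B * (r / k)) * k ^ (2 * B * (B + 1)) := by
          gcongr
          exact one_sub_half_rpow_le hB (by positivity) hsmall

end Potential

variable {V E : Type*} (G : MultiHypergraph V E)

section Cuts

lemma minCut_le {C : Finset E} (hC : G.IsCut C) : G.minCut ≤ #C :=
  Nat.sInf_le ⟨C, hC, rfl⟩

lemma isCut_univ [Nontrivial V] [Fintype E] : G.IsCut univ :=
  let ⟨u, v, huv⟩ := exists_pair_ne V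
  ⟨{u}, ⟨u, rfl⟩, ⟨v, huv.symm⟩, fun e => absurd (mem_univ _) e.2⟩

lemma exists_isCut_card_eq_minCut [Nontrivial V] [Finite E] :
    ∃ C : Finset E, G.IsCut C ∧ #C = G.minCut :=
  have := Fintype.ofFinite E
  Nat.sInf_mem (s := {k | ∃ C : Finset E, G.IsCut C ∧ #C = k}) ⟨_, univ, G.isCut_univ, rfl⟩

open Classical in
lemma isCut_star [Nontrivial V] [Fintype E] (x : V) :
    G.IsCut {e | x ∈ G.verts e ∧ 2 ≤ G.rank e} := by
  obtain ⟨y, hyx⟩ := exists_ne x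
  refine ⟨{x}, ⟨x, rfl⟩, ⟨y, hyx⟩, fun ⟨e, he⟩ => ?_⟩
  simp only [mem_filter_univ, not_and, not_le] at he
  by_cases hx : x ∈ G.verts e
  · exact Or.inl fun v hv => card_le_one.mp (Nat.le_of_lt_succ (he hx)) v hv x hx
  · exact Or.inr fun v hv hvx => hx (Set.mem_singleton_iff.mp hvx ▸ hv)

open Classical in
lemma numVertices_mul_minCut_le_sum_rank [Finite V] [Nontrivial V] [Fintype E] :
    G.numVertices * G.minCut ≤ ∑ e with 2 ≤ G.rank e, G.rank e := by
  have := Fintype.ofFinite V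
  calc G.numVertices * G.minCut = ∑ _x : V, G.minCut := by simp [numVertices]
    _ ≤ ∑ x, #{e ∈ {e | 2 ≤ G.rank e} | x ∈ G.verts e} := sum_le_sum fun x _ => by
        simpa only [filter_filter, and_comm] using G.minCut_le (G.isCut_star x)
    _ = ∑ e with 2 ≤ G.rank e, #{x | x ∈ G.verts e} :=
        sum_card_bipartiteAbove_eq_sum_card_bipartiteBelow fun x e => x ∈ G.verts e
    _ = ∑ e with 2 ≤ G.rank e, G.rank e := by simp only [filter_univ_mem, rank]

end Cuts

section Contraction

lemma contractSetoid_mono : Monotone G.contractSetoid := fun _ _ hF _ _ =>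
  Relation.EqvGen.mono (fun _ _ ⟨e, he, huv⟩ => ⟨e, hF he, huv⟩) _ _

lemma rank_contract_le (F : Finset E) (e : E) : (G.contract F).rank e ≤ G.rank e := by
  classical exact card_image_le

lemma numVertices_contract_le [Finite V] (F : Finset E) :
    (G.contract F).numVertices ≤ G.numVertices :=
  Nat.card_le_card_of_surjective _ Quotient.mk_surjective

lemma isCut_of_isCut_contract {F C : Finset E} (hC : (G.contract F).IsCut C) : G.IsCut C := by
  obtain ⟨S, hS, hS', hsides⟩ := hC
  refine ⟨Quotient.mk _ ⁻¹' S, hS.preimage Quotient.mk_surjective,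
    hS'.preimage Quotient.mk_surjective, fun e => ?_⟩
  have hmem : ∀ v ∈ G.verts e, Quotient.mk _ v ∈ (G.contract F).verts e := by
    classical exact fun v hv => mem_image_of_mem _ hv
  exact (hsides e).imp (fun h v hv => h (hmem v hv)) fun h v hv => h (hmem v hv)

lemma minCut_le_minCut_contract [Finite E] (F : Finset E)
    [Nontrivial (Quotient (G.contractSetoid F))] :
    G.minCut ≤ (G.contract F).minCut := by
  obtain ⟨C, hC, hcard⟩ := (G.contract F).exists_isCut_card_eq_minCut
  exact hcard ▸ G.minCut_le (G.isCut_of_isCut_contract hC)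

lemma numVertices_contract_insert_add_rank_le [Finite V] [DecidableEq E] (F : Finset E) (e : E) :
    (G.contract (insert e F)).numVertices + (G.contract F).rank e ≤
      (G.contract F).numVertices + 1 := by
  obtain ⟨v₀, hv₀⟩ := G.verts_nonempty e
  have hle : G.contractSetoid F ≤ G.contractSetoid (insert e F) :=
    G.contractSetoid_mono (subset_insert e F)
  let proj : Quotient (G.contractSetoid F) → Quotient (G.contractSetoid (insert e F)) :=
    Quotient.map id fun _ _ h => hle h
  have hproj : proj.Surjective := fun y =>
    let ⟨v, hv⟩ := Quotient.mk_surjective y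
    ⟨Quotient.mk _ v, hv⟩
  refine natCard_add_card_le_of_surjective hproj (b := Quotient.mk _ v₀) fun x hx => ?_
  classical
  obtain ⟨v, hv, rfl⟩ := mem_image.mp hx
  exact Quotient.sound (.rel _ _ ⟨e, mem_insert_self e F, hv, hv₀⟩)

end Contraction

section TailBound

open Classical in
lemma rpow_mul_probNumVerticesGe_le_subsetExpectation [Fintype E] {c α q : ℝ} (hc : 0 ≤ c)
    (hα : 0 ≤ α) (hq : 0 ≤ q) (hq1 : q ≤ 1) :
    c ^ α * G.probNumVerticesGe q c ≤
      subsetExpectation q fun F => potential c α (G.contract F).numVertices := by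
  simp only [probNumVerticesGe, prod_ite_mem_eq_subsetWeight, subsetExpectation, mul_sum]
  refine sum_le_sum fun F _ => ?_
  have hweight := subsetWeight_nonneg hq hq1 F
  split_ifs with h
  · rw [potential_of_le h, mul_comm]
    gcongr
  · rw [mul_zero]
    exact mul_nonneg hweight (potential_nonneg hc _)

variable [Finite V]

lemma potential_contract_insert_le [DecidableEq E] {c α : ℝ} (hc : 0 ≤ c) (hα : 0 ≤ α)
    (F : Finset E) (e : E) :
    potential c α (G.contract (insert e F)).numVertices ≤
      potential c α (G.contract F).numVertices := by
  have hrank_pos : 0 < (G.contract F).rank e := card_pos.mpr ((G.contract F).verts_nonempty e)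
  have hnum := G.numVertices_contract_insert_add_rank_le F e
  exact monotone_potential hc hα (Nat.cast_le.mpr (by lia))

lemma mul_rank_div_mul_potential_le_sub [DecidableEq E] {B R c : ℝ} (hB : 0 < B)
    (hc : B * R + 1 ≤ c) (hrank : ∀ e, (G.rank e : ℝ) ≤ R) {F : Finset E} {e : E}
    (he : 2 ≤ (G.contract F).rank e) (hF : c ≤ (G.contract F).numVertices) :
    B * ((G.contract F).rank e / (G.contract F).numVertices) *
        potential c (2 * B * (B + 1)) (G.contract F).numVertices ≤
      potential c (2 * B * (B + 1)) (G.contract F).numVertices -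
        potential c (2 * B * (B + 1)) (G.contract (insert e F)).numVertices := by
  have hrankR : ((G.contract F).rank e : ℝ) ≤ R :=
    (Nat.cast_le.mpr (G.rank_contract_le F e)).trans (hrank e)
  have hnum : ((G.contract (insert e F)).numVertices : ℝ) ≤
      (G.contract F).numVertices - (G.contract F).rank e + 1 := by
    have hnum_nat := G.numVertices_contract_insert_add_rank_le F e
    rify at hnum_nat
    linarith
  linarith [potential_le_one_sub_mul_potential hB hc (Nat.ofNat_le_cast.mpr he) hrankR hF hnum]

variable [Fintype E]

lemma mul_minCut_mul_potential_le_sum_sub [DecidableEq E] {B R c : ℝ} (hB : 0 < B) (hR : 0 < R)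
    (hc : B * R + 1 ≤ c) (hrank : ∀ e, (G.rank e : ℝ) ≤ R) (F : Finset E) :
    B * G.minCut * potential c (2 * B * (B + 1)) (G.contract F).numVertices ≤
      ∑ e, (potential c (2 * B * (B + 1)) (G.contract F).numVertices -
        potential c (2 * B * (B + 1)) (G.contract (insert e F)).numVertices) := by
  set f := potential c (2 * B * (B + 1))
  set H := G.contract F
  have hc1 : 1 < c := by nlinarith
  have hdrop : ∀ e, 0 ≤ f H.numVertices - f (G.contract (insert e F)).numVertices := fun e =>
    sub_nonneg.mpr (G.potential_contract_insert_le (by linarith) (by positivity) F e)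
  rcases lt_or_ge (H.numVertices : ℝ) c with hH | hH
  · exact (mul_eq_zero_of_right _ (potential_of_lt hH)).trans_le (sum_nonneg fun e _ => hdrop e)
  have hH0 : 0 < (H.numVertices : ℝ) := by linarith
  have : Nontrivial (Quotient (G.contractSetoid F)) :=
    Finite.one_lt_card_iff_nontrivial.mp (mod_cast hc1.trans_le hH : 1 < H.numVertices)
  have hcuts : (H.numVertices * G.minCut : ℝ) ≤ ∑ e with 2 ≤ H.rank e, (H.rank e : ℝ) := by
    exact_mod_cast (Nat.mul_le_mul_left _ (G.minCut_le_minCut_contract F)).trans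
      H.numVertices_mul_minCut_le_sum_rank
  calc B * G.minCut * f H.numVertices
      = B / H.numVertices * f H.numVertices * (H.numVertices * G.minCut) := by field_simp
    _ ≤ B / H.numVertices * f H.numVertices * ∑ e with 2 ≤ H.rank e, (H.rank e : ℝ) :=
        mul_le_mul_of_nonneg_left hcuts
          (mul_nonneg (by positivity) (potential_nonneg (by linarith) _))
    _ = ∑ e with 2 ≤ H.rank e, B * (H.rank e / H.numVertices) * f H.numVertices := by
        rw [mul_sum]
        exact sum_congr rfl fun e _ => by ring
    _ ≤ ∑ e with 2 ≤ H.rank e, (f H.numVertices - f (G.contract (insert e F)).numVertices) :=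
        sum_le_sum fun e he =>
          G.mul_rank_div_mul_potential_le_sub hB hc hrank (mem_filter.mp he).2 hH
    _ ≤ ∑ e, (f H.numVertices - f (G.contract (insert e F)).numVertices) :=
        sum_le_sum_of_subset_of_nonneg (filter_subset _ _) fun e _ _ => hdrop e

theorem probNumVerticesGe_le_div_rpow_mul {B R c q : ℝ} (hB : 0 < B) (hR : 0 < R)
    (hc : B * R + 1 ≤ c) (hrank : ∀ e, (G.rank e : ℝ) ≤ R) (hq : 0 < q) (hq1 : q ≤ 1) :
    G.probNumVerticesGe q c ≤
      (G.numVertices / c) ^ (2 * B * (B + 1)) * q ^ (B * (G.minCut : ℝ)) := by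
  classical
  have hc0 : 0 < c := by nlinarith
  have hα : 0 ≤ 2 * B * (B + 1) := by positivity
  have hstart : potential c (2 * B * (B + 1)) (G.contract ∅).numVertices ≤
      G.numVertices ^ (2 * B * (B + 1)) :=
    (potential_le_rpow (Nat.cast_nonneg _)).trans <|
      rpow_le_rpow (Nat.cast_nonneg _) (Nat.cast_le.mpr (G.numVertices_contract_le ∅)) hα
  rw [div_rpow (Nat.cast_nonneg _) hc0.le, div_mul_eq_mul_div, le_div_iff₀' (by positivity)]
  calc c ^ (2 * B * (B + 1)) * G.probNumVerticesGe q c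
      ≤ subsetExpectation q fun F => potential c (2 * B * (B + 1)) (G.contract F).numVertices :=
        G.rpow_mul_probNumVerticesGe_le_subsetExpectation hc0.le hα hq.le hq1
    _ ≤ potential c (2 * B * (B + 1)) (G.contract ∅).numVertices * q ^ (B * (G.minCut : ℝ)) :=
        subsetExpectation_le_mul_rpow
          (G.mul_minCut_mul_potential_le_sum_sub hB hR hc hrank) hq hq1
    _ ≤ G.numVertices ^ (2 * B * (B + 1)) * q ^ (B * (G.minCut : ℝ)) := by gcongr

end TailBound

end MultiHypergraph

theorem mainTheorem5_general {V E : Type*} [Finite V] [Fintype E] (G : MultiHypergraph V E)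
    {A B c q : ℝ} (hA : 0 < A) (hB : 0 < B) (hn : exp (2 * (A + 1)) ≤ G.numVertices)
    (hrank : ∀ e, (G.rank e : ℝ) ≤ G.numVertices / A) (hc : B * (G.numVertices / A) + 1 ≤ c)
    (hq : 0 < q) (hq1 : q ≤ 1) :
    G.probNumVerticesGe q c <
      (G.numVertices : ℝ) ^ (A ^ 2 / B) * q ^ (B * (G.minCut : ℝ)) := by
  have hn0 : 0 < (G.numVertices : ℝ) := (exp_pos _).trans_le hn
  have hBR : 0 < B * (G.numVertices / A) := by positivity
  have hc0 : 0 < c := by linarith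
  calc G.probNumVerticesGe q c
      ≤ (G.numVertices / c) ^ (2 * B * (B + 1)) * q ^ (B * (G.minCut : ℝ)) :=
        G.probNumVerticesGe_le_div_rpow_mul hB (by positivity) hc hrank hq hq1
    _ ≤ (G.numVertices / (B * (G.numVertices / A))) ^ (2 * B * (B + 1)) *
          q ^ (B * (G.minCut : ℝ)) := by
        gcongr
        linarith
    _ = (A / B) ^ (2 * B * (B + 1)) * q ^ (B * (G.minCut : ℝ)) := by
        congr 2
        field_simp
    _ < (G.numVertices : ℝ) ^ (A ^ 2 / B) * q ^ (B * (G.minCut : ℝ)) :=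
        mul_lt_mul_of_pos_right (div_rpow_lt_rpow_sq_div hA hB hn) (by positivity)

lemma MultiHypergraph.probNumVerticesGe_four_fifths_le {V E : Type*} [Finite V] [Fintype E]
    (G : MultiHypergraph V E) {q : ℝ} (hn : exp 6 ≤ G.numVertices)
    (hrank : ∀ e, (G.rank e : ℝ) ≤ G.numVertices / 2) (hq : 0 < q) (hq1 : q ≤ 1) :
    G.probNumVerticesGe q (0.8 * G.numVertices) ≤
      (G.numVertices : ℝ) ^ (2.7 : ℝ) * q ^ (1.5 * (G.minCut : ℝ)) := by
  have hn_exp : exp (2 * (2 + 1)) ≤ G.numVertices := by norm_num [hn]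
  have hn20 : 20 ≤ (G.numVertices : ℝ) := by
    linarith [quadratic_le_exp_of_nonneg (x := 6) (by norm_num)]
  calc G.probNumVerticesGe q (0.8 * G.numVertices)
      ≤ (G.numVertices : ℝ) ^ ((2 : ℝ) ^ 2 / 1.5) * q ^ (1.5 * (G.minCut : ℝ)) :=
        (mainTheorem5_general G two_pos (by norm_num) hn_exp hrank (by linarith) hq hq1).le
    _ ≤ (G.numVertices : ℝ) ^ (2.7 : ℝ) * q ^ (1.5 * (G.minCut : ℝ)) := by
        gcongr
        · linarith
        · norm_num

theorem mainTheorem5 :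
    (∀ A : ℝ, 1 < A → ∃ n₀ : ℕ, ∀ B : ℝ, 1 < B → B < A →
      ∀ (V : Type*) (E : Type*) [Finite V] [Fintype E] (G : MultiHypergraph V E),
        n₀ ≤ G.numVertices →
        (∀ e : E, (G.rank e : ℝ) ≤ (G.numVertices : ℝ) / A) →
        ∀ q : ℝ, 0 < q → q < 1 →
          G.probNumVerticesGe q ((⌈B * ((G.numVertices : ℝ) / A)⌉ : ℝ) + 1) <
            (G.numVertices : ℝ) ^ (A ^ 2 / B) * q ^ (B * (G.minCut : ℝ))) ∧
    (∃ n₀ : ℕ,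
      ∀ (V : Type*) (E : Type*) [Finite V] [Fintype E] (G : MultiHypergraph V E),
        n₀ ≤ G.numVertices →
        (∀ e : E, (G.rank e : ℝ) ≤ (G.numVertices : ℝ) / 2) →
        ∀ q : ℝ, 0 < q → q < 1 →
          G.probNumVerticesGe q (0.8 * (G.numVertices : ℝ)) ≤
            (G.numVertices : ℝ) ^ (2.7 : ℝ) * q ^ (1.5 * (G.minCut : ℝ))) := by
  refine ⟨fun A hA => ⟨⌈exp (2 * (A + 1))⌉₊, fun B hB _ V E _ _ G hn hrank q hq hq1 => ?_⟩,
    ⟨⌈exp 6⌉₊, fun V E _ _ G hn hrank q hq hq1 => ?_⟩⟩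
  · exact mainTheorem5_general G (one_pos.trans hA) (one_pos.trans hB) (Nat.ceil_le.mp hn) hrank
      (add_le_add_left (Int.le_ceil _) 1) hq hq1.le
  · exact G.probNumVerticesGe_four_fifths_le (Nat.ceil_le.mp hn) hrank hq hq1.le
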